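/- Conventions. $\mathbf{Met}$ is the category of extended metric spaces (distance $\infty$ allowed) and nonexpanding maps; its hom-sets carry the supremum metric $d(f,g)=\sup_x d(f(x),g(x))$. Every $n\in\mathbb N$ is regarded as the discrete space $\{0,\dots,n-1\}$ (non-zero distances are $\infty$). For a finitary signature $\Sigma$, a quantitative $\Sigma$-algebra is a metric space $A$ with operations $\sigma_A\colon A^n\to A$ ($\sigma\in\Sigma_n$) that are nonexpanding for the maximum metric on $A^n$; morphisms are the nonexpanding homomorphisms. A variety $\mathcal V$ is a full subcategory of the category of quantitative $\Sigma$-algebras specified by a set of equations $t=_\varepsilon t'$ ($t,t'$ terms in finitely many variables, $\varepsilon\ge 0$ real), where $A$ satisfies $t=_\varepsilon t'$ iff the values of $t$ and $t'$ under every interpretation of the variables in $A$ have distance at most $\varepsilon$. Its forgetful functor $U_{\mathcal V}\colon\mathcal V\to\mathbf{Met}$ has a left adjoint $F_{\mathcal V}$; $T_{\mathcal V}=U_{\mathcal V}F_{\mathcal V}$ is the resulting monad, and $K_{\mathcal V}\colon\mathcal V\to\mathbf{Met}^{T_{\mathcal V}}$ is the comparison functor into the category of Eilenberg–Moore algebras.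 Homomorphisms in $\mathcal V$ have the distance of their underlying maps. $\mathcal Var(\mathbf{Met})$ is the category of all varieties (for arbitrary signatures) and concrete functors, i.e. locally nonexpanding functors $G\colon\mathcal V\to\mathcal W$ with $U_{\mathcal W}G=U_{\mathcal V}$. The distance of $G,G'\colon\mathcal V\to\mathcal W$ is $d(G,G')=\sup d(t_{GA},t_{G'A})$, where $t$ ranges over all terms in $n$ variables over the signature of $\mathcal W$, $A$ over the free algebras $F_{\mathcal V}k$ ($n,k\in\mathbb N$), and $t_{GA}$ is the $n$-ary operation of $GA$ given by $t$. $\mathrm{Mnd}_f(\mathbf{Met})$ is the category of monads on $\mathbf{Met}$ whose endofunctor is locally nonexpanding and preserves directed colimits, with all monad morphisms; the distance of $\varphi,\psi\colon S\to T$ is $\sup_{n\in\mathbb N}d(\varphi_n,\psi_n)$. A $\mathbf{PMet}$-enriched category is a category with an extended pseudometric on every hom-set such that $d(g f,g' f')\le d(f,f')+d(g,g')$; a $\mathbf{PMet}$-enriched functor is a locally nonexpanding one, and it is fully faithful if it is bijective and distance-preserving on every hom-set. **Proposition.** With these distances $\mathcal Var(\mathbf{Met})$ and $\mathrm{Mnd}_f(\mathbf{Met})$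 are $\mathbf{PMet}$-enriched categories, every $K_{\mathcal V}$ is an isomorphism of categories, and the following defines a $\mathbf{PMet}$-enriched, fully faithful functor $$\Phi\colon\mathcal Var(\mathbf{Met})^{\mathrm{op}}\to\mathrm{Mnd}_f(\mathbf{Met}).$$ It assigns to every variety $\mathcal V$ the monad $T_{\mathcal V}$ (which is, in particular, enriched and finitary). Given a concrete functor $H\colon\mathcal V\to\mathcal W$, $\Phi(H)\colon T_{\mathcal W}\to T_{\mathcal V}$ is the monad morphism corresponding to the composite $$\mathbf{Met}^{T_{\mathcal V}}\xrightarrow{K_{\mathcal V}^{-1}}\mathcal V\xrightarrow{H}\mathcal W\xrightarrow{K_{\mathcal W}}\mathbf{Met}^{T_{\mathcal W}},$$ that is, the unique monad morphism $\gamma\colon T_{\mathcal W}\to T_{\mathcal V}$ such that this composite is the functor given by $(A,\alpha)\mapsto(A,\alpha\cdot\gamma_A)$ on objects and by the identity on underlying maps. -/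

import Mathlib

open CategoryTheory
open scoped ENNReal NNReal

universe u v

noncomputable section

namespace MetVar

/-! ### The category of extended metric spaces -/

/-- An extended metric space (distance `∞` is allowed; distance `0` forces equality). -/
structure Met : Type (u + 1) where
  carrier : Type u
  [inst : EMetricSpace carrier]

instance : CoeSort Met.{u} (Type u) := ⟨Met.carrier⟩

instance (X : Met.{u}) : EMetricSpace X := X.inst

/-- Nonexpanding maps. -/
@[ext]
structure Met.Hom (X Y : Met.{u}) : Type u where
  toFun : X → Y
  nonexp : ∀ x x' : X, edist (toFun x) (toFun x') ≤ edist x x'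

instance : Category.{u} Met.{u} where
  Hom X Y := Met.Hom X Y
  id X := ⟨fun x => x, fun _ _ => le_rfl⟩
  comp f g := ⟨fun x => g.toFun (f.toFun x), fun x x' => (g.nonexp _ _).trans (f.nonexp x x')⟩

theorem Met.hom_ext {X Y : Met.{u}} {f g : X ⟶ Y} (h : ∀ x, f.toFun x = g.toFun x) : f = g :=
  Met.Hom.ext (funext h)

@[simp] theorem Met.id_toFun (X : Met.{u}) (x : X) : (𝟙 X : X ⟶ X).toFun x = x := rfl

@[simp] theorem Met.comp_toFun {X Y Z : Met.{u}} (f : X ⟶ Y) (g : Y ⟶ Z) (x : X) :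
    (f ≫ g).toFun x = g.toFun (f.toFun x) := rfl

/-- The supremum metric on the set of morphisms from `X` to `Y`. -/
def Met.homDist {X Y : Met.{u}} (f g : X ⟶ Y) : ℝ≥0∞ :=
  ⨆ x : X, edist (f.toFun x) (g.toFun x)

/-- The discrete space `n = {0, …, n - 1}`: all non-zero distances are `∞`. -/
def Met.disc (n : ℕ) : Met.{u} where
  carrier := ULift.{u} (Fin n)
  inst :=
    { edist := fun i j => if i = j then 0 else ⊤
      edist_self := fun i => if_pos rfl
      edist_comm := fun i j => by simp only [eq_comm]
      edist_triangle := fun i j k => by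
        by_cases hij : i = j
        · subst hij; simp
        · simp [hij]
      eq_of_edist_eq_zero := fun {i j} h => by
        by_contra hij
        simp [hij] at h }

/-! ### Quantitative algebras -/

/-- A finitary signature: `S n` is the set of `n`-ary operation symbols. -/
abbrev Signature : Type (u + 1) := ℕ → Type u

/-- Terms over the signature `S` with variables in `X`. -/
inductive Term (S : Signature.{u}) (X : Type v) : Type (max u v)
  | var (x : X) : Term S X
  | op {n : ℕ} (σ : S n) (ts : Fin n → Term S X) : Term S X

/-- Quantitative algebras: a metric space with nonexpanding operations. The distance on
`Fin n → A` is the maximum metric. -/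
structure QAlg (S : Signature.{u}) : Type (u + 1) where
  toMet : Met.{u}
  op : ∀ {n : ℕ}, S n → (Fin n → toMet) → toMet
  op_nonexp : ∀ {n : ℕ} (σ : S n) (x y : Fin n → toMet), edist (op σ x) (op σ y) ≤ edist x y

/-- Nonexpanding homomorphisms. -/
@[ext]
structure QAlg.Hom {S : Signature.{u}} (A B : QAlg S) : Type u where
  toHom : A.toMet ⟶ B.toMet
  map_op : ∀ {n : ℕ} (σ : S n) (x : Fin n → A.toMet),
    toHom.toFun (A.op σ x) = B.op σ (fun i => toHom.toFun (x i))

instance (S : Signature.{u}) : Category.{u} (QAlg S) where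
  Hom A B := QAlg.Hom A B
  id A := ⟨𝟙 A.toMet, fun _ _ => rfl⟩
  comp f g := ⟨f.toHom ≫ g.toHom, fun σ x => by
    rw [Met.comp_toFun, f.map_op, g.map_op]; rfl⟩

/-- The forgetful functor from quantitative algebras to metric spaces. -/
def QAlg.forget (S : Signature.{u}) : QAlg S ⥤ Met.{u} where
  obj A := A.toMet
  map f := f.toHom

/-- The value `f^#(t)` of the term `t` under the interpretation `f` of its variables. -/
def Term.eval {S : Signature.{u}} (A : QAlg S) {X : Type v} (f : X → A.toMet) :
    Term S X → A.toMet
  | .var x => f x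
  | .op σ ts => A.op σ (fun i => Term.eval A f (ts i))

/-- A quantitative equation `lhs =_ε rhs` between terms in finitely many variables. -/
structure QEq (S : Signature.{u}) : Type u where
  n : ℕ
  lhs : Term S (Fin n)
  rhs : Term S (Fin n)
  ε : ℝ≥0

/-- The algebra `A` satisfies the equation `e`. -/
def QAlg.Satisfies {S : Signature.{u}} (A : QAlg S) (e : QEq S) : Prop :=
  ∀ f : Fin e.n → A.toMet, edist (e.lhs.eval A f) (e.rhs.eval A f) ≤ (e.ε : ℝ≥0∞)

/-! ### Varieties -/

/-- A variety: a signature together with a class of quantitative algebras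
that is specified by a set of quantitative equations. -/
structure Variety : Type (u + 1) where
  sig : Signature.{u}
  mem : ObjectProperty (QAlg sig)
  exists_eqs : ∃ E : Set (QEq sig), ∀ A : QAlg sig, mem A ↔ ∀ e ∈ E, A.Satisfies e

namespace Variety

/-- A variety as a full subcategory of the category of quantitative algebras. -/
abbrev Alg (V : Variety.{u}) : Type (u + 1) := V.mem.FullSubcategory

/-- The forgetful functor of a variety. -/
def forget (V : Variety.{u}) : V.Alg ⥤ Met.{u} := V.mem.ι ⋙ QAlg.forget V.sig

/-- The distance of parallel homomorphisms in a variety. -/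
def homDist (V : Variety.{u}) {A B : V.Alg} (f g : A ⟶ B) : ℝ≥0∞ :=
  Met.homDist (V.forget.map f) (V.forget.map g)

end Variety

/-! ### Free algebras of a variety -/

theorem Term.map_eval {S : Signature.{u}} {A B : QAlg S} (h : A ⟶ B) {X : Type v}
    (f : X → A.toMet) (t : Term S X) :
    h.toHom.toFun (t.eval A f) = t.eval B (fun x => h.toHom.toFun (f x)) := by
  induction t with
  | var x => rfl
  | op σ ts ih =>
    simp only [Term.eval]
    rw [h.map_op]
    exact congrArg _ (funext ih)

/-- Substitution of terms for variables. -/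
def Term.subst {S : Signature.{u}} {X : Type v} {Y : Type u} (g : X → Term S Y) :
    Term S X → Term S Y
  | .var x => g x
  | .op σ ts => .op σ (fun i => Term.subst g (ts i))

theorem Term.eval_subst {S : Signature.{u}} (A : QAlg S) {X : Type v} {Y : Type u}
    (g : X → Term S Y) (f : Y → A.toMet) (t : Term S X) :
    (t.subst g).eval A f = t.eval A (fun x => (g x).eval A f) := by
  induction t with
  | var x => rfl
  | op σ ts ih => exact congrArg (A.op σ) (funext ih)

namespace Variety

variable (V : Variety.{u}) (X : Met.{u})

/-- Terms over the space `X`, to be metrized according to the variety `V`. -/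
def PreFree : Type u := Term V.sig X

/-- The distance of two terms is the largest distance of their values under
nonexpanding interpretations in algebras of `V`. -/
instance : PseudoEMetricSpace (V.PreFree X) where
  edist s t := ⨆ (A : V.Alg) (f : X ⟶ V.forget.obj A),
    edist (Term.eval A.obj f.toFun s) (Term.eval A.obj f.toFun t)
  edist_self s := by simp
  edist_comm s t := by simp only [edist_comm]
  edist_triangle r s t := by
    refine iSup₂_le fun A f => (edist_triangle _ (Term.eval A.obj f.toFun s) _).trans ?_
    exact add_le_add
      (le_iSup₂ (f := fun (A : V.Alg) (f : X ⟶ V.forget.obj A) =>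
        edist (Term.eval A.obj f.toFun r) (Term.eval A.obj f.toFun s)) A f)
      (le_iSup₂ (f := fun (A : V.Alg) (f : X ⟶ V.forget.obj A) =>
        edist (Term.eval A.obj f.toFun s) (Term.eval A.obj f.toFun t)) A f)

variable {V X}

theorem PreFree.eval_le (s t : V.PreFree X) (A : V.Alg) (f : X ⟶ V.forget.obj A) :
    edist (Term.eval A.obj f.toFun s) (Term.eval A.obj f.toFun t) ≤ edist s t :=
  le_iSup₂ (f := fun (A : V.Alg) (f : X ⟶ V.forget.obj A) =>
    edist (Term.eval A.obj f.toFun s) (Term.eval A.obj f.toFun t)) A f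

theorem PreFree.edist_le {s t : V.PreFree X} {c : ℝ≥0∞}
    (h : ∀ (A : V.Alg) (f : X ⟶ V.forget.obj A),
      edist (Term.eval A.obj f.toFun s) (Term.eval A.obj f.toFun t) ≤ c) :
    edist s t ≤ c :=
  iSup₂_le h

/-- The term `σ(ts)`. -/
def PreFree.op {n : ℕ} (σ : V.sig n) (ts : Fin n → V.PreFree X) : V.PreFree X :=
  Term.op σ ts

theorem PreFree.op_nonexp {n : ℕ} (σ : V.sig n) (s t : Fin n → V.PreFree X) :
    edist (PreFree.op σ s) (PreFree.op σ t) ≤ edist s t := by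
  refine PreFree.edist_le fun A f => ?_
  refine (A.obj.op_nonexp σ _ _).trans (edist_pi_le_iff.2 fun i => ?_)
  exact (PreFree.eval_le (s i) (t i) A f).trans (edist_le_pi_edist s t i)

variable (V X)

/-- The space of the free algebra: terms modulo distance `0`. -/
def freeMet : Met.{u} where
  carrier := SeparationQuotient (V.PreFree X)

variable {V X}

/-- The element of the free algebra represented by a term. -/
def freeMk (t : V.PreFree X) : V.freeMet X := SeparationQuotient.mk t

theorem edist_freeMk (s t : V.PreFree X) :
    edist (freeMk s : V.freeMet X) (freeMk t) = edist s t :=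
  SeparationQuotient.edist_mk s t

theorem freeMk_surjective : Function.Surjective (freeMk : V.PreFree X → V.freeMet X) :=
  SeparationQuotient.surjective_mk

/-- A term representing an element of the free algebra. -/
def freeRep (x : V.freeMet X) : V.PreFree X := Function.surjInv freeMk_surjective x

theorem freeMk_freeRep (x : V.freeMet X) : freeMk (freeRep x) = x :=
  Function.surjInv_eq freeMk_surjective x

theorem edist_freeRep (x y : V.freeMet X) : edist (freeRep x) (freeRep y) = edist x y := by
  rw [← edist_freeMk, freeMk_freeRep, freeMk_freeRep]

theorem edist_freeRep_freeMk (t : V.PreFree X) :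
    edist (freeRep (freeMk t : V.freeMet X)) t = 0 := by
  rw [← edist_freeMk, freeMk_freeRep, edist_self]

/-- The operations of the free algebra, computed on representing terms. -/
def freeOp {n : ℕ} (σ : V.sig n) (x : Fin n → V.freeMet X) : V.freeMet X :=
  freeMk (PreFree.op σ (fun i => freeRep (x i)))

theorem freeOp_freeMk {n : ℕ} (σ : V.sig n) (ts : Fin n → V.PreFree X) :
    freeOp σ (fun i => (freeMk (ts i) : V.freeMet X)) = freeMk (PreFree.op σ ts) := by
  refine edist_le_zero.1 ?_
  refine (edist_freeMk _ _).trans_le ((PreFree.op_nonexp σ _ _).trans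
    (edist_pi_le_iff.2 fun i => (edist_freeRep_freeMk (ts i)).le))

variable (V X)

/-- The free algebra as a quantitative algebra. -/
def freeQAlg : QAlg V.sig where
  toMet := V.freeMet X
  op := freeOp
  op_nonexp := fun {n} σ x y => by
    obtain ⟨s, rfl⟩ : ∃ s : Fin n → V.PreFree X, (fun i => freeMk (s i)) = x :=
      ⟨fun i => freeRep (x i), funext fun i => freeMk_freeRep _⟩
    obtain ⟨t, rfl⟩ : ∃ t : Fin n → V.PreFree X, (fun i => freeMk (t i)) = y :=
      ⟨fun i => freeRep (y i), funext fun i => freeMk_freeRep _⟩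
    rw [freeOp_freeMk, freeOp_freeMk, edist_freeMk]
    refine (PreFree.op_nonexp σ s t).trans (edist_pi_le_iff.2 fun i => ?_)
    rw [← edist_freeMk]
    exact edist_le_pi_edist (fun i => (freeMk (s i) : V.freeMet X)) (fun i => freeMk (t i)) i

variable {V X}

theorem eval_freeQAlg {Y : Type v} (g : Y → V.PreFree X) (t : Term V.sig Y) :
    t.eval (V.freeQAlg X) (fun y => freeMk (g y)) = freeMk (Term.subst g t : Term V.sig X) := by
  induction t with
  | var y => rfl
  | op σ ts ih =>
    refine (congrArg (freeOp σ) (funext ih)).trans ?_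
    exact freeOp_freeMk σ _

theorem freeQAlg_mem : V.mem (V.freeQAlg X) := by
  obtain ⟨E, hE⟩ := V.exists_eqs
  refine (hE _).2 fun e he f => ?_
  obtain ⟨g, rfl⟩ : ∃ g : Fin e.n → V.PreFree X, (fun i => freeMk (g i)) = f :=
    ⟨fun i => freeRep (f i), funext fun i => freeMk_freeRep _⟩
  rw [eval_freeQAlg, eval_freeQAlg]
  refine (edist_freeMk _ _).trans_le (PreFree.edist_le fun A h => ?_)
  erw [Term.eval_subst, Term.eval_subst]
  exact (hE A.obj).1 A.property e he _

variable (V X)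

/-- The free algebra of the variety `V` on the space `X`. -/
def freeAlg : V.Alg := ⟨V.freeQAlg X, freeQAlg_mem⟩

/-- The universal morphism into the free algebra. -/
def freeUnit : X ⟶ V.forget.obj (V.freeAlg X) where
  toFun x := freeMk (Term.var x : Term V.sig X)
  nonexp x x' := (edist_freeMk _ _).trans_le (PreFree.edist_le fun _ f => f.nonexp x x')

variable {V X}

/-- The extension of a nonexpanding map to a homomorphism on the free algebra. -/
def freeLift {A : V.Alg} (f : X ⟶ V.forget.obj A) : V.freeAlg X ⟶ A :=
  ObjectProperty.homMk
    { toHom :=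
        { toFun := fun x => Term.eval A.obj f.toFun (freeRep x)
          nonexp := fun x y => (PreFree.eval_le _ _ A f).trans (edist_freeRep x y).le }
      map_op := fun σ x => edist_le_zero.1 ((PreFree.eval_le _
        (PreFree.op σ (fun i => freeRep (x i))) A f).trans
          (edist_freeRep_freeMk (PreFree.op σ (fun i => freeRep (x i)))).le) }

theorem freeLift_freeMk {A : V.Alg} (f : X ⟶ V.forget.obj A) (t : V.PreFree X) :
    (freeLift f).hom.toHom.toFun (freeMk t) = Term.eval A.obj f.toFun t :=
  edist_le_zero.1 ((PreFree.eval_le _ t A f).trans (edist_freeRep_freeMk t).le)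

/-- Every element of the free algebra is the value of a term in the generators. -/
theorem freeMk_eq_eval (t : V.PreFree X) :
    freeMk t = Term.eval (V.freeQAlg X) (V.freeUnit X).toFun t := by
  induction (show Term V.sig X from t) with
  | var x => rfl
  | op σ ts ih =>
    refine (freeOp_freeMk σ ts).symm.trans ?_
    exact congrArg (freeOp σ) (funext ih)

/-- Homomorphisms out of the free algebra on `X` are nonexpanding maps out of `X`. -/
def freeEquiv (X : Met.{u}) (A : V.Alg) : (V.freeAlg X ⟶ A) ≃ (X ⟶ V.forget.obj A) where
  toFun h := V.freeUnit X ≫ V.forget.map h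
  invFun := freeLift
  left_inv h := by
    refine ObjectProperty.hom_ext _ (QAlg.Hom.ext (Met.hom_ext fun x => ?_))
    obtain ⟨t, rfl⟩ := freeMk_surjective x
    rw [freeLift_freeMk, freeMk_eq_eval]
    exact (Term.map_eval h.hom _ _).symm
  right_inv f := Met.hom_ext fun x => freeLift_freeMk f (Term.var x : Term V.sig X)

variable (V)

/-- The free-algebra functor. -/
def free : Met.{u} ⥤ V.Alg :=
  Adjunction.leftAdjointOfEquiv (G := V.forget) (F_obj := V.freeAlg) freeEquiv
    (fun _ _ _ _ _ => rfl)

/-- The free-algebra functor is left adjoint to the forgetful functor. -/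
def adj : V.free ⊣ V.forget :=
  Adjunction.adjunctionOfEquivLeft (G := V.forget) (F_obj := V.freeAlg) freeEquiv
    (fun _ _ _ _ _ => rfl)

/-- The free-algebra monad `T_V` on the category of metric spaces. -/
def monad : Monad Met.{u} := V.adj.toMonad

/-- The comparison functor `K_V` from the variety to the Eilenberg-Moore category of `T_V`. -/
def comparison : V.Alg ⥤ V.monad.Algebra := Monad.comparison V.adj

end Variety

/-! ### Categories enriched over pseudometric spaces -/

/-- A distance function on every hom-set of a category. -/
abbrev HomDist (C : Type*) [Category C] := ∀ ⦃X Y : C⦄, (X ⟶ Y) → (X ⟶ Y) → ℝ≥0∞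

/-- The same distances, on the opposite category. -/
def HomDist.op {C : Type*} [Category C] (d : HomDist C) : HomDist Cᵒᵖ :=
  fun _ _ f g => d f.unop g.unop

/-- The given distances make the category enriched over (extended) pseudometric spaces:
they are pseudometrics, and composition is nonexpanding for the sum metric. -/
structure IsPMetEnriched {C : Type*} [Category C] (d : HomDist C) : Prop where
  dist_self : ∀ {X Y : C} (f : X ⟶ Y), d f f = 0
  dist_comm : ∀ {X Y : C} (f g : X ⟶ Y), d f g = d g f
  dist_triangle : ∀ {X Y : C} (f g h : X ⟶ Y), d f h ≤ d f g + d g h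
  dist_comp : ∀ {X Y Z : C} (f f' : X ⟶ Y) (g g' : Y ⟶ Z),
    d (f ≫ g) (f' ≫ g') ≤ d f f' + d g g'

/-- An enriched functor: it is locally nonexpanding. -/
def IsEnrichedFunctor {C D : Type*} [Category C] [Category D] (d : HomDist C) (d' : HomDist D)
    (F : C ⥤ D) : Prop :=
  ∀ {X Y : C} (f g : X ⟶ Y), d' (F.map f) (F.map g) ≤ d f g

/-- A fully faithful enriched functor: on every hom-space it is a bijection preserving distances. -/
structure IsEnrichedFullyFaithful {C D : Type*} [Category C] [Category D] (d : HomDist C)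
    (d' : HomDist D) (F : C ⥤ D) : Prop where
  bijective : ∀ X Y : C, Function.Bijective (fun f : X ⟶ Y => F.map f)
  dist_map : ∀ {X Y : C} (f g : X ⟶ Y), d' (F.map f) (F.map g) = d f g

/-! ### Enriched finitary monads -/

/-- An endofunctor is finitary if it preserves colimits indexed by directed posets. -/
def IsFinitary (F : Met.{u} ⥤ Met.{u}) : Prop :=
  ∀ (J : Type u) [PartialOrder J] [IsDirectedOrder J] [Nonempty J],
    Limits.PreservesColimitsOfShape J F

/-- Enriched finitary monads. -/
def enrichedFinitary : ObjectProperty (Monad Met.{u}) := fun T =>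
  IsEnrichedFunctor (fun _ _ f g => Met.homDist f g) (fun _ _ f g => Met.homDist f g)
    T.toFunctor ∧ IsFinitary T.toFunctor

/-- The category of enriched finitary monads and monad morphisms. -/
abbrev FinMnd : Type (u + 1) := (enrichedFinitary.{u}).FullSubcategory

/-- The distance of monad morphisms: the supremum of the distances of the components
at the finite discrete spaces. -/
def FinMnd.dist : HomDist FinMnd.{u} := fun _ _ φ ψ =>
  ⨆ n : ℕ, Met.homDist (φ.hom.app (Met.disc n)) (ψ.hom.app (Met.disc n))

/-! ### The category of varieties -/

/-- Concrete functors between varieties: locally nonexpanding functors that commute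
(strictly) with the forgetful functors. -/
@[ext]
structure ConcreteFunctor (V W : Variety.{u}) : Type (u + 1) where
  toFunctor : V.Alg ⥤ W.Alg
  nonexp : ∀ {A B : V.Alg} (f g : A ⟶ B),
    W.homDist (toFunctor.map f) (toFunctor.map g) ≤ V.homDist f g
  comp_forget : toFunctor ⋙ W.forget = V.forget

instance : Category.{u + 1} Variety.{u} where
  Hom V W := ConcreteFunctor V W
  id V := ⟨𝟭 _, fun _ _ => le_rfl, rfl⟩
  comp G H := ⟨G.toFunctor ⋙ H.toFunctor, fun f g => (H.nonexp _ _).trans (G.nonexp f g), by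
    rw [Functor.assoc, H.comp_forget, G.comp_forget]⟩

/-- The algebra `G A` has the same underlying space as `A`. -/
theorem ConcreteFunctor.forget_obj {V W : Variety.{u}} (G : V ⟶ W) (A : V.Alg) :
    W.forget.obj (G.toFunctor.obj A) = V.forget.obj A :=
  Functor.congr_obj G.comp_forget A

/-- The operation `t_{GA}` on the common underlying space of `GA` and `A`, given by the term `t`. -/
def ConcreteFunctor.termOp {V W : Variety.{u}} (G : V ⟶ W) (A : V.Alg) {n : ℕ}
    (t : Term W.sig (Fin n)) (x : Fin n → V.forget.obj A) : V.forget.obj A :=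
  (eqToHom (ConcreteFunctor.forget_obj G A)).toFun
    (t.eval (G.toFunctor.obj A).obj
      (fun i => (eqToHom (ConcreteFunctor.forget_obj G A).symm).toFun (x i)))

/-- The distance of concrete functors `G, G' : V ⟶ W`: the supremum of the distances of the
operations `t_{GA}` and `t_{G'A}`, over all terms `t` in `n` variables and all
free algebras `A` of `V` on finite discrete spaces `k`. -/
def Variety.dist : HomDist Variety.{u} := fun V W G G' =>
  ⨆ (n : ℕ) (k : ℕ) (t : Term W.sig (Fin n))
    (x : Fin n → V.forget.obj (V.free.obj (Met.disc k))),
    edist (ConcreteFunctor.termOp G (V.free.obj (Met.disc k)) t x)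
      (ConcreteFunctor.termOp G' (V.free.obj (Met.disc k)) t x)

end MetVar

end

noncomputable section

namespace MetVar

/-! ### Functors over the base between categories of algebras are monad morphisms -/

section AlgebraFunctors

universe v₁ v₂ v₃ u₁ u₂ u₃

/-! Functors `T.Algebra ⥤ S.Algebra` that strictly commute with the forgetful functors correspond to
monad morphisms `S ⟶ T`. Such a functor puts an `S`-action on the carrier of every free algebra
`TX`, and composing this action with `S η` gives `γ_X`. Every algebra receives its structure map as
a homomorphism from a free algebra, so these actions determine the functor. Since each `K_V` is an
isomorphism, concrete functors `V ⟶ W` then correspond to monad morphisms `T_W ⟶ T_V`. Local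
nonexpansion is automatic, because underlying maps do not change.

`K_V` is invertible because a `T_V`-algebra `(A, a)` carries the operations `σ(x) = a[σ(x)]`. These
make `a` a nonexpanding homomorphism from the free algebra, split by the unit, so the equations of
`V` descend to `A`. The monad is enriched because term operations are nonexpanding for the supremum
metric. It is finitary because finite arities let directed colimits in `V` be formed on underlying
spaces.

For distances, every element of `T_W n` is the class of a term `t` in `n` variables, and `γ_n[t]` is
the value of `t` at the generators of `G(F_V n)` (`termOp_free`). A tuple in `F_V k` extends to a
nonexpanding homomorphism from `F_V n`, which sends `γ_n[t]` to the value of `t` at that tuple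
(`termOp_comp`). Hence the two suprema agree, and the enrichment of varieties is pulled back from
that of monads. -/

theorem functor_eq_of_comp_faithful {B : Type u₁} [Category.{v₁} B] {D : Type u₂} [Category.{v₂} D]
    {E : Type u₃} [Category.{v₃} E] {F : D ⥤ E} [F.Faithful] {L L' : B ⥤ D}
    (h : L ⋙ F = L' ⋙ F) (hobj : ∀ X, L.obj X = L'.obj X) : L = L' := by
  refine CategoryTheory.Functor.ext hobj fun X Y f => F.map_injective ?_
  simp only [Functor.map_comp, eqToHom_map]
  exact Functor.congr_hom h f

variable {C : Type u₁} [Category.{v₁} C] {S T : CategoryTheory.Monad C}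

/-- The action of an algebra, moved along an equality of carriers. -/
def castAction (X : S.Algebra) {B : C} (e : X.A = B) : S.obj B ⟶ B :=
  S.map (eqToHom e.symm) ≫ X.a ≫ eqToHom e

theorem castAction_rfl (X : S.Algebra) : castAction X rfl = X.a := by simp [castAction]

/-- The strict equation over the base identifies carriers only propositionally. With the target
carriers left as variables, `subst` removes every transport here and in the two laws that follow. -/
theorem castAction_naturality {X Y : S.Algebra} (g : X ⟶ Y) {A B : C} (eX : X.A = A)
    (eY : Y.A = B) (f : A ⟶ B) (hg : g.f = eqToHom eX ≫ f ≫ eqToHom eY.symm) :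
    S.map f ≫ castAction Y eY = castAction X eX ≫ f := by
  subst eX eY
  have hf : f = g.f := by simpa using hg.symm
  subst hf
  simp [castAction]

theorem unit_castAction (X : S.Algebra) {B : C} (e : X.A = B) :
    S.η.app B ≫ castAction X e = 𝟙 B := by
  subst e
  simp [castAction, X.unit]

theorem assoc_castAction (X : S.Algebra) {B : C} (e : X.A = B) :
    S.μ.app B ≫ castAction X e = S.map (castAction X e) ≫ castAction X e := by
  subst e
  simp [castAction, X.assoc]

theorem algebra_eq_mk (X : S.Algebra) {B : C} (e : X.A = B)
    (b : S.obj B ⟶ B) (hb : b = castAction X e) (h₁ h₂) : X = ⟨B, b, h₁, h₂⟩ := by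
  subst e
  have : b = X.a := by simpa [castAction] using hb
  subst this
  rfl

section

variable (L : T.Algebra ⥤ S.Algebra) (h : L ⋙ S.forget = T.forget)

include h in
theorem carrier_obj_eq (A : T.Algebra) : (L.obj A).A = A.A := Functor.congr_obj h A

/-- The `S`-action on the carrier of a `T`-algebra given by a functor over the base. -/
def transportedAction (A : T.Algebra) : S.obj A.A ⟶ A.A :=
  castAction (L.obj A) (carrier_obj_eq L h A)

theorem transportedAction_naturality {A B : T.Algebra} (f : A ⟶ B) :
    S.map f.f ≫ transportedAction L h B = transportedAction L h A ≫ f.f :=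
  castAction_naturality (L.map f) _ _ _ (Functor.congr_hom h f)

/-- The `S`-action on the carrier of the free `T`-algebra on `X`. -/
def freeAction (X : C) : S.obj (T.obj X) ⟶ T.obj X :=
  transportedAction L h (T.free.obj X)

theorem freeAction_naturality {X Y : C} (f : X ⟶ Y) :
    S.map (T.map f) ≫ freeAction L h Y = freeAction L h X ≫ T.map f :=
  transportedAction_naturality L h (T.free.map f)

/-- By associativity, `A.a` is itself a morphism of `T`-algebras from the free algebra to `A`, so
naturality applies to it. -/
theorem map_comp_transportedAction (A : T.Algebra) :
    S.map A.a ≫ transportedAction L h A = freeAction L h A.A ≫ A.a :=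
  transportedAction_naturality L h (A := T.free.obj A.A) (B := A) ⟨A.a, A.assoc.symm⟩

theorem unit_freeAction (X : C) : S.η.app (T.obj X) ≫ freeAction L h X = 𝟙 (T.obj X) :=
  unit_castAction _ _

theorem assoc_freeAction (X : C) : S.μ.app (T.obj X) ≫ freeAction L h X =
    S.map (freeAction L h X) ≫ freeAction L h X :=
  assoc_castAction _ _

theorem map_mul_comp_freeAction (X : C) :
    S.map (T.μ.app X) ≫ freeAction L h X = freeAction L h (T.obj X) ≫ T.μ.app X :=
  map_comp_transportedAction L h (T.free.obj X)

/-- The monad morphism corresponding to a functor over the base. -/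
def monadHomOfFunctor : S ⟶ T where
  app X := S.map (T.η.app X) ≫ freeAction L h X
  naturality X Y f := by
    have h1 := T.η.naturality f
    dsimp at h1
    rw [← S.map_comp_assoc, h1, S.map_comp_assoc, freeAction_naturality, Category.assoc]
  app_η X := by
    have h1 := S.η.naturality (T.η.app X)
    dsimp at h1
    rw [← reassoc_of% h1, unit_freeAction, Category.comp_id]
  app_μ X := by
    have h1 := S.μ.naturality (T.η.app X)
    dsimp at h1
    -- Being compatible with the `S`-actions, the multiplication of `T` can be moved under `S`,
    -- where it cancels the unit of `T`.
    rw [← reassoc_of% h1, assoc_freeAction, Category.assoc, Category.assoc,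
      ← map_mul_comp_freeAction, ← S.map_comp_assoc (T.η.app _)]
    simp

theorem monadHomOfFunctor_app_comp (A : T.Algebra) :
    (monadHomOfFunctor L h).app A.A ≫ A.a = transportedAction L h A := by
  change (S.map (T.η.app A.A) ≫ freeAction L h A.A) ≫ A.a = _
  rw [Category.assoc, ← map_comp_transportedAction, ← S.map_comp_assoc, A.unit]
  simp

theorem algebraFunctor_monadHomOfFunctor :
    Monad.algebraFunctorOfMonadHom (monadHomOfFunctor L h) = L := by
  refine functor_eq_of_comp_faithful (F := S.forget) h.symm fun A => ?_
  exact (algebra_eq_mk _ (carrier_obj_eq L h A) _ (monadHomOfFunctor_app_comp L h A) _ _).symm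

end

/-- Naturality at the unit and a unit law recover `γ_X` from the restriction along `γ` of the free
algebra on `X`. -/
theorem algebraFunctorOfMonadHom_injective {γ γ' : S ⟶ T}
    (h : Monad.algebraFunctorOfMonadHom γ = Monad.algebraFunctorOfMonadHom γ') : γ = γ' := by
  refine MonadHom.ext (funext fun X => ?_)
  have key : ∀ δ : S ⟶ T, δ.app X = S.map (T.η.app X) ≫ δ.app (T.obj X) ≫ T.μ.app X := by
    intro δ
    have := δ.naturality (T.η.app X)
    dsimp at this
    rw [reassoc_of% this]
    simp
  have ha : γ.app (T.obj X) ≫ T.μ.app X = γ'.app (T.obj X) ≫ T.μ.app X := by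
    have := Functor.congr_obj h (T.free.obj X)
    -- The type of the structure map depends on the algebra, so the equality of algebras is read off
    -- through `HEq`.
    have h2 := congrArg (fun A : S.Algebra => HEq A.a (γ'.app (T.obj X) ≫ T.μ.app X)) this
    exact eq_of_heq (h2.mpr HEq.rfl)
  exact (key γ).trans ((congrArg (S.map (T.η.app X) ≫ ·) ha).trans (key γ').symm)

end AlgebraFunctors

/-! ### The comparison functor is an isomorphism -/

instance (S : Signature.{u}) : (QAlg.forget S).Faithful where
  map_injective h := QAlg.Hom.ext h

namespace Variety

variable {V : Variety.{u}}

instance : V.forget.Faithful := inferInstanceAs (V.mem.ι ⋙ QAlg.forget V.sig).Faithful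

theorem monad_map_freeMk {X Y : Met.{u}} (f : X ⟶ Y) (t : Term V.sig X) :
    (V.monad.map f).toFun (freeMk t : V.freeMet X) =
      t.eval (V.freeQAlg Y) (fun x => (V.freeUnit Y).toFun (f.toFun x)) :=
  freeLift_freeMk (A := V.freeAlg Y) (f ≫ V.freeUnit Y) t

theorem monad_μ_freeMk (X : Met.{u}) (t : Term V.sig (V.freeMet X)) :
    (V.monad.μ.app X).toFun (freeMk t : V.freeMet (V.freeMet X)) =
      t.eval (V.freeQAlg X) (fun x => x) :=
  freeLift_freeMk (A := V.freeAlg X) (𝟙 _) t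

theorem comparison_a_freeMk (A : V.Alg) (t : Term V.sig (V.forget.obj A)) :
    (V.comparison.obj A).a.toFun (freeMk t : V.freeMet (V.forget.obj A)) =
      t.eval A.obj (fun x => x) :=
  freeLift_freeMk (A := A) (𝟙 _) t

/-! ### Algebras for `T_V` as quantitative algebras in `V` -/

variable (A : V.monad.Algebra)

/-- The structure map of an algebra for `T_V`, as a map on the free algebra. -/
def structureMap : V.freeMet A.A ⟶ A.A := A.a

theorem structureMap_var (x : A.A) :
    (structureMap A).toFun ((V.freeUnit A.A).toFun x) = x :=
  congrArg (fun f => f.toFun x) A.unit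

/-- Associativity of the algebra at the term `σ(x)` whose variables are elements of the free
algebra: `μ` flattens this term, while `T a` applies `a` to each variable. -/
theorem structureMap_freeOp {n : ℕ} (σ : V.sig n) (x : Fin n → V.freeMet A.A) :
    (structureMap A).toFun (freeOp σ x) =
      (structureMap A).toFun (freeMk (Term.op σ fun i => .var ((structureMap A).toFun (x i)))) := by
  have h := congrArg (fun f => f.toFun (freeMk (Term.op σ fun i => .var (x i)) :
    V.freeMet (V.freeMet A.A))) A.assoc
  have h' := congrArg (structureMap A).toFun
    (monad_μ_freeMk (V := V) A.A (Term.op σ fun i => .var (x i)))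
  refine (h'.symm.trans h).trans (congrArg (structureMap A).toFun ?_)
  refine (monad_map_freeMk (V := V) (structureMap A) _).trans ?_
  exact freeOp_freeMk σ _

/-- The quantitative algebra given by an algebra for `T_V`. -/
def toQAlg : QAlg V.sig where
  toMet := A.A
  op σ x := (structureMap A).toFun (freeMk (Term.op σ fun i => .var (x i)))
  op_nonexp σ x y := by
    refine ((structureMap A).nonexp _ _).trans ?_
    refine (edist_freeMk _ _).trans_le (PreFree.edist_le fun B f => ?_)
    refine (B.obj.op_nonexp σ _ _).trans (edist_pi_le_iff.2 fun i => ?_)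
    exact (f.nonexp _ _).trans (edist_le_pi_edist x y i)

theorem eval_toQAlg {X : Type v} (f : X → V.freeMet A.A) (t : Term V.sig X) :
    t.eval (toQAlg A) (fun x => (structureMap A).toFun (f x)) =
      (structureMap A).toFun (t.eval (V.freeQAlg A.A) f) := by
  induction t with
  | var x => rfl
  | op σ ts ih =>
    refine (congrArg ((toQAlg A).op σ) (funext ih)).trans ?_
    exact (structureMap_freeOp A σ _).symm

theorem eval_toQAlg_eq {X : Type v} (f : X → A.A) (t : Term V.sig X) :
    t.eval (toQAlg A) f =
      (structureMap A).toFun (t.eval (V.freeQAlg A.A) fun x => (V.freeUnit A.A).toFun (f x)) := by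
  refine Eq.trans ?_ (eval_toQAlg A _ t)
  exact congrArg (fun g => t.eval (toQAlg A) g) (funext fun x => (structureMap_var A (f x)).symm)

/-- Interpretations in `A` lift along the unit to the free algebra, which satisfies the equations.
The structure map commutes with evaluation and does not increase distances. -/
theorem toQAlg_mem : V.mem (toQAlg A) := by
  obtain ⟨E, hE⟩ := V.exists_eqs
  refine (hE _).2 fun e he f => ?_
  refine (congrArg₂ edist (eval_toQAlg_eq A f e.lhs) (eval_toQAlg_eq A f e.rhs)).trans_le ?_
  exact ((structureMap A).nonexp _ _).trans ((hE _).1 freeQAlg_mem e he _)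

variable (V) in
/-- The inverse of the comparison functor. -/
def comparisonInv : V.monad.Algebra ⥤ V.Alg where
  obj A := ⟨toQAlg A, toQAlg_mem A⟩
  map {A B} f := ObjectProperty.homMk
    { toHom := f.f
      map_op := fun σ x => by
        have h := congrArg (fun g => g.toFun (freeMk (Term.op σ fun i => .var (x i)) :
          V.freeMet A.A)) f.h
        refine Eq.trans h.symm (congrArg (structureMap B).toFun ?_)
        refine (monad_map_freeMk (V := V) f.f (Term.op σ fun i => .var (x i))).trans ?_
        exact freeOp_freeMk σ _ }

theorem comparison_comp_comparisonInv : V.comparison ⋙ V.comparisonInv = 𝟭 V.Alg := by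
  refine functor_eq_of_comp_faithful (F := V.forget) rfl fun A => ?_
  obtain ⟨⟨X, op, h⟩, hA⟩ := A
  refine ObjectProperty.FullSubcategory.ext ?_
  change QAlg.mk _ _ _ = QAlg.mk _ _ _
  -- The space is unchanged, so only the operations have to be compared.
  congr 1
  funext n σ x
  exact comparison_a_freeMk (V := V) ⟨⟨X, op, h⟩, hA⟩ (Term.op σ fun i => .var (x i))

theorem comparisonInv_comp_comparison : V.comparisonInv ⋙ V.comparison = 𝟭 V.monad.Algebra := by
  refine functor_eq_of_comp_faithful (F := V.monad.forget) rfl fun A => ?_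
  refine algebra_eq_mk ((V.comparisonInv ⋙ V.comparison).obj A) (B := A.A) rfl A.a ?_ A.unit A.assoc
  refine Eq.trans ?_ (castAction_rfl ((V.comparisonInv ⋙ V.comparison).obj A)).symm
  refine Met.hom_ext fun x => ?_
  obtain ⟨t, rfl⟩ := freeMk_surjective (V := V) x
  refine Eq.trans ?_ (comparison_a_freeMk (V.comparisonInv.obj A) t).symm
  rw [freeMk_eq_eval]
  exact (eval_toQAlg_eq A (fun x => x) t).symm

end Variety

/-! ### The free-algebra monad is enriched -/

/-- A supremum replaces the maximum metric because the set of variables may be infinite. -/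
theorem Term.edist_eval_le {S : Signature.{u}} (A : QAlg S) {X : Type v} (f g : X → A.toMet)
    (t : Term S X) : edist (t.eval A f) (t.eval A g) ≤ ⨆ x, edist (f x) (g x) := by
  induction t with
  | var x => exact le_iSup (fun x => edist (f x) (g x)) x
  | op σ ts ih => exact (A.op_nonexp σ _ _).trans (edist_pi_le_iff.2 ih)

theorem Variety.monad_enriched (V : Variety.{u}) :
    IsEnrichedFunctor (fun _ _ f g => Met.homDist f g) (fun _ _ f g => Met.homDist f g)
      V.monad.toFunctor := by
  intro X Y f g
  refine iSup_le fun x => ?_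
  obtain ⟨t, rfl⟩ := Variety.freeMk_surjective (V := V) x
  refine (congrArg₂ edist (monad_map_freeMk f t) (monad_map_freeMk g t)).trans_le ?_
  refine (Term.edist_eval_le _ _ _ t).trans (iSup_le fun x => ?_)
  exact ((V.freeUnit Y).nonexp _ _).trans (le_iSup (fun x => edist (f.toFun x) (g.toFun x)) x)

/-! ### Directed colimits of metric spaces -/

section DirectedColimits

open Limits

variable {J : Type u} [PartialOrder J]

theorem Met.map_comp_apply {D : J ⥤ Met.{u}} {i j k : J} (f : i ⟶ j) (g : j ⟶ k) (x : D.obj i) :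
    (D.map g).toFun ((D.map f).toFun x) = (D.map (f ≫ g)).toFun x := by
  rw [D.map_comp, Met.comp_toFun]

theorem Met.cocone_w_apply {D : J ⥤ Met.{u}} (c : Cocone D) {i j : J} (f : i ⟶ j) (x : D.obj i) :
    (c.ι.app j).toFun ((D.map f).toFun x) = (c.ι.app i).toFun x :=
  congrArg (fun g => g.toFun x) (c.w f)

/-- A cocone of metric spaces that is jointly surjective and in which distances are
approximated by distances in the diagram. -/
structure Met.IsDirectedColimit {D : J ⥤ Met.{u}} (c : Cocone D) : Prop where
  surj : ∀ y : c.pt, ∃ (j : J) (x : D.obj j), (c.ι.app j).toFun x = y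
  dist : ∀ (j : J) (x y : D.obj j) (r : ℝ≥0∞),
    edist ((c.ι.app j).toFun x) ((c.ι.app j).toFun y) < r →
      ∃ (k : J) (f : j ⟶ k), edist ((D.map f).toFun x) ((D.map f).toFun y) < r

variable [IsDirectedOrder J]

namespace Met.IsDirectedColimit

variable {D : J ⥤ Met.{u}} {c : Cocone D} (hc : Met.IsDirectedColimit c)
include hc

/-- A distance below `r` in `c` is already below `r` at some stage of the diagram, and the maps to
`s` do not increase it. This makes `desc` both well defined and nonexpanding. -/
theorem edist_le (s : Cocone D) {j k : J} (x : D.obj j) (y : D.obj k) :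
    edist ((s.ι.app j).toFun x) ((s.ι.app k).toFun y) ≤
      edist ((c.ι.app j).toFun x) ((c.ι.app k).toFun y) := by
  refine le_of_forall_gt fun r hr => ?_
  obtain ⟨l, hjl, hkl⟩ := exists_ge_ge j k
  rw [← Met.cocone_w_apply c (homOfLE hjl), ← Met.cocone_w_apply c (homOfLE hkl)] at hr
  obtain ⟨m, f, hm⟩ := hc.dist _ _ _ _ hr
  rw [← Met.cocone_w_apply s (homOfLE hjl), ← Met.cocone_w_apply s (homOfLE hkl),
    ← Met.cocone_w_apply s f, ← Met.cocone_w_apply s f]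
  exact ((s.ι.app m).nonexp _ _).trans_lt hm

/-- The factorization of a cocone. -/
def desc (s : Cocone D) : c.pt ⟶ s.pt where
  toFun y := (s.ι.app (hc.surj y).choose).toFun (hc.surj y).choose_spec.choose
  nonexp y y' := by
    refine (hc.edist_le s _ _).trans_eq ?_
    rw [(hc.surj y).choose_spec.choose_spec, (hc.surj y').choose_spec.choose_spec]

theorem desc_apply (s : Cocone D) {j : J} (x : D.obj j) :
    (hc.desc s).toFun ((c.ι.app j).toFun x) = (s.ι.app j).toFun x := by
  refine edist_le_zero.1 ((hc.edist_le s _ x).trans_eq ?_)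
  rw [(hc.surj ((c.ι.app j).toFun x)).choose_spec.choose_spec, edist_self]

/-- Such a cocone is a colimit. -/
def isColimit : IsColimit c where
  desc := hc.desc
  fac s j := Met.hom_ext fun x => hc.desc_apply s x
  uniq s m hm := Met.hom_ext fun y => by
    obtain ⟨j, x, rfl⟩ := hc.surj y
    rw [hc.desc_apply, ← hm j, Met.comp_toFun]

variable [Nonempty J]

theorem exists_rep {n : ℕ} (y : Fin n → c.pt) :
    ∃ (j : J) (x : Fin n → D.obj j), (fun i => (c.ι.app j).toFun (x i)) = y := by
  choose j x hx using fun i => hc.surj (y i)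
  obtain ⟨k, hk⟩ := Finite.exists_le j
  refine ⟨k, fun i => (D.map (homOfLE (hk i))).toFun (x i), funext fun i => ?_⟩
  rw [Met.cocone_w_apply, hx]

/-- Each coordinate needs its own later stage, and finitely many stages have a common upper bound.
Finiteness of arities enters here and in `exists_rep`. -/
theorem exists_edist_lt {n : ℕ} {j k : J} (x : Fin n → D.obj j) (y : Fin n → D.obj k)
    {r : ℝ≥0∞} (hr : ∀ i, edist ((c.ι.app j).toFun (x i)) ((c.ι.app k).toFun (y i)) < r) :
    ∃ (l : J) (f : j ⟶ l) (g : k ⟶ l), ∀ i,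
      edist ((D.map f).toFun (x i)) ((D.map g).toFun (y i)) < r := by
  obtain ⟨l, hjl, hkl⟩ := exists_ge_ge j k
  have h : ∀ i, ∃ (m : J) (f : l ⟶ m),
      edist ((D.map f).toFun ((D.map (homOfLE hjl)).toFun (x i)))
        ((D.map f).toFun ((D.map (homOfLE hkl)).toFun (y i))) < r := fun i => by
    refine hc.dist l _ _ r ?_
    rw [Met.cocone_w_apply, Met.cocone_w_apply]
    exact hr i
  choose m f hf using h
  obtain ⟨p, hp⟩ := Finite.exists_le m
  -- For `n = 0` nothing forces `p` to lie above `l`.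
  obtain ⟨q, hlq, hpq⟩ := exists_ge_ge l p
  refine ⟨q, homOfLE (hjl.trans hlq), homOfLE (hkl.trans hlq), fun i => ?_⟩
  refine lt_of_le_of_lt ?_ (hf i)
  refine Eq.trans_le ?_ ((D.map (homOfLE ((hp i).trans hpq))).nonexp _ _)
  simp only [Met.map_comp_apply]
  rfl

end Met.IsDirectedColimit

/-- The elements of the spaces of a directed diagram, to be metrized. -/
def Met.PreColimit (D : J ⥤ Met.{u}) : Type u := Σ j, D.obj j

instance (D : J ⥤ Met.{u}) : PseudoEMetricSpace (Met.PreColimit D) where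
  edist p q := ⨅ k : {k : J // p.1 ≤ k ∧ q.1 ≤ k},
    edist ((D.map (homOfLE k.2.1)).toFun p.2) ((D.map (homOfLE k.2.2)).toFun q.2)
  edist_self p := le_antisymm (iInf_le_of_le ⟨p.1, le_rfl, le_rfl⟩ (edist_self _).le) zero_le
  edist_comm p q := le_antisymm
    (le_iInf fun k => iInf_le_of_le ⟨k.1, k.2.2, k.2.1⟩ (edist_comm _ _).le)
    (le_iInf fun k => iInf_le_of_le ⟨k.1, k.2.2, k.2.1⟩ (edist_comm _ _).le)
  edist_triangle p q r := by
    refine ENNReal.le_iInf_add_iInf fun k l => ?_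
    -- Distances can only shrink along the diagram, so both are compared at one common later stage.
    obtain ⟨m, hkm, hlm⟩ := exists_ge_ge k.1 l.1
    refine iInf_le_of_le ⟨m, k.2.1.trans hkm, l.2.2.trans hlm⟩ ?_
    refine (edist_triangle _ ((D.map (homOfLE (k.2.2.trans hkm))).toFun q.2) _).trans
      (add_le_add ?_ ?_)
    · refine Eq.trans_le ?_ ((D.map (homOfLE hkm)).nonexp _ _)
      simp only [Met.map_comp_apply]
      rfl
    · refine Eq.trans_le ?_ ((D.map (homOfLE hlm)).nonexp _ _)
      simp only [Met.map_comp_apply]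
      rfl

/-- The colimit of a directed diagram of metric spaces. -/
def Met.colimitCocone (D : J ⥤ Met.{u}) : Cocone D where
  pt := { carrier := SeparationQuotient (Met.PreColimit D) }
  ι :=
    { app := fun j =>
        { toFun := fun x => SeparationQuotient.mk (⟨j, x⟩ : Met.PreColimit D)
          nonexp := fun x y => (SeparationQuotient.edist_mk _ _).trans_le
            (iInf_le_of_le ⟨j, le_rfl, le_rfl⟩ ((D.map _).nonexp x y)) }
      naturality := fun j k f => Met.hom_ext fun x => by
        refine edist_le_zero.1 ((SeparationQuotient.edist_mk _ _).trans_le ?_)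
        refine iInf_le_of_le ⟨k, le_rfl, leOfHom f⟩ ?_
        simp only [Met.map_comp_apply]
        exact (edist_self _).le }

theorem Met.colimitCocone_isDirectedColimit (D : J ⥤ Met.{u}) :
    Met.IsDirectedColimit (Met.colimitCocone D) where
  surj y := by
    obtain ⟨⟨j, x⟩, rfl⟩ := SeparationQuotient.surjective_mk (X := Met.PreColimit D) y
    exact ⟨j, x, rfl⟩
  dist j x y r h := by
    have h' := (SeparationQuotient.edist_mk (X := Met.PreColimit D) ⟨j, x⟩ ⟨j, y⟩).symm.trans_lt h
    obtain ⟨k, hk⟩ := iInf_lt_iff.1 h'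
    exact ⟨k.1, homOfLE k.2.1, hk⟩

/-! ### Directed colimits in a variety -/

namespace Variety

variable {V : Variety.{u}} {D : J ⥤ V.Alg}

omit [IsDirectedOrder J] in
theorem map_op (D : J ⥤ V.Alg) {j k : J} (f : j ⟶ k) {n : ℕ} (σ : V.sig n)
    (x : Fin n → V.forget.obj (D.obj j)) :
    (V.forget.map (D.map f)).toFun ((D.obj j).obj.op σ x) =
      (D.obj k).obj.op σ (fun i => (V.forget.map (D.map f)).toFun (x i)) :=
  (D.map f).hom.map_op σ x

variable [Nonempty J] {c : Cocone (D ⋙ V.forget)}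
  (hc : Met.IsDirectedColimit c)

include hc in
-- Allowing representatives from two different stages makes the operation on the colimit independent
-- of choices as well as nonexpanding.
theorem edist_op_le {n : ℕ} (σ : V.sig n) {j k : J}
    (x : Fin n → V.forget.obj (D.obj j)) (y : Fin n → V.forget.obj (D.obj k)) :
    edist ((c.ι.app j).toFun ((D.obj j).obj.op σ x)) ((c.ι.app k).toFun ((D.obj k).obj.op σ y)) ≤
      edist (fun i => (c.ι.app j).toFun (x i)) (fun i => (c.ι.app k).toFun (y i)) := by
  refine le_of_forall_gt_imp_ge_of_dense fun r hr => ?_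
  obtain ⟨l, f, g, h⟩ := hc.exists_edist_lt x y fun i =>
    (edist_le_pi_edist (fun i => (c.ι.app j).toFun (x i))
      (fun i => (c.ι.app k).toFun (y i)) i).trans_lt hr
  refine (congrArg₂ edist (Met.cocone_w_apply c f _) (Met.cocone_w_apply c g _)).symm.trans_le ?_
  refine ((c.ι.app l).nonexp _ _).trans ?_
  refine (congrArg₂ edist (map_op D f σ x) (map_op D g σ y)).trans_le ?_
  exact ((D.obj l).obj.op_nonexp σ _ _).trans (edist_pi_le_iff.2 fun i => (h i).le)

/-- The colimit of a directed diagram of algebras, on the colimit of the underlying spaces. -/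
def colimitQAlg : QAlg V.sig where
  toMet := c.pt
  op σ y := (c.ι.app (hc.exists_rep y).choose).toFun
    ((D.obj _).obj.op σ (hc.exists_rep y).choose_spec.choose)
  op_nonexp σ y z := by
    refine (edist_op_le hc σ _ _).trans_eq ?_
    rw [(hc.exists_rep y).choose_spec.choose_spec, (hc.exists_rep z).choose_spec.choose_spec]

theorem colimitQAlg_op {n : ℕ} (σ : V.sig n) {j : J} (x : Fin n → V.forget.obj (D.obj j)) :
    (colimitQAlg hc).op σ (fun i => (c.ι.app j).toFun (x i)) =
      (c.ι.app j).toFun ((D.obj j).obj.op σ x) := by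
  refine edist_le_zero.1 ((edist_op_le hc σ _ x).trans_eq ?_)
  rw [(hc.exists_rep fun i => (c.ι.app j).toFun (x i)).choose_spec.choose_spec, edist_self]

/-- The coprojections into the colimit are homomorphisms. -/
def colimitQAlgι (j : J) : (D.obj j).obj ⟶ colimitQAlg hc where
  toHom := c.ι.app j
  map_op σ x := (colimitQAlg_op hc σ x).symm

/-- An equation has finitely many variables, so an interpretation already lives at one stage, whose
algebra satisfies the equation. -/
theorem colimitQAlg_mem : V.mem (colimitQAlg hc) := by
  obtain ⟨E, hE⟩ := V.exists_eqs
  refine (hE _).2 fun e he f => ?_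
  obtain ⟨j, x, rfl⟩ := hc.exists_rep f
  refine (congrArg₂ edist (Term.map_eval (colimitQAlgι hc j) x e.lhs)
    (Term.map_eval (colimitQAlgι hc j) x e.rhs)).symm.trans_le ?_
  exact ((c.ι.app j).nonexp _ _).trans ((hE _).1 (D.obj j).property e he x)

/-- The colimit cocone in the variety. -/
def colimitAlgCocone : Cocone D where
  pt := ⟨colimitQAlg hc, colimitQAlg_mem hc⟩
  ι :=
    { app := fun j => ObjectProperty.homMk (colimitQAlgι hc j)
      naturality := fun _ _ f => V.forget.map_injective (c.ι.naturality f) }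

/-- The factorization of a cocone in the variety. -/
def colimitAlgDesc (s : Cocone D) : (colimitAlgCocone hc).pt ⟶ s.pt :=
  ObjectProperty.homMk
    { toHom := hc.desc (V.forget.mapCocone s)
      map_op := fun {n} σ y => by
        obtain ⟨j, x, rfl⟩ := hc.exists_rep y
        refine (congrArg _ (colimitQAlg_op hc σ x)).trans ?_
        refine (hc.desc_apply (V.forget.mapCocone s) _).trans ?_
        refine ((s.ι.app j).hom.map_op σ x).trans (congrArg _ (funext fun i => ?_))
        exact (hc.desc_apply (V.forget.mapCocone s) (x i)).symm }

/-- The cocone in the variety is a colimit. -/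
def colimitAlgIsColimit : IsColimit (colimitAlgCocone hc) where
  desc := colimitAlgDesc hc
  fac s j := V.forget.map_injective (hc.isColimit.fac (V.forget.mapCocone s) j)
  uniq s m hm := V.forget.map_injective
    (hc.isColimit.uniq (V.forget.mapCocone s) (V.forget.map m) fun j =>
      congrArg V.forget.map (hm j))

instance : PreservesColimitsOfShape J V.forget where
  preservesColimit {D} :=
    -- The forgetful functor sends the colimit cocone built in `V` definitionally to the one it was
    -- built from.
    preservesColimit_of_preserves_colimit_cocone
      (colimitAlgIsColimit (Met.colimitCocone_isDirectedColimit (D ⋙ V.forget)))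
      (Met.colimitCocone_isDirectedColimit (D ⋙ V.forget)).isColimit

variable (V) in
theorem monad_preservesDirectedColimits : PreservesColimitsOfShape J V.monad.toFunctor :=
  have : PreservesColimitsOfSize.{u, u} V.free := V.adj.leftAdjoint_preservesColimits
  inferInstanceAs (PreservesColimitsOfShape J (V.free ⋙ V.forget))

end Variety

end DirectedColimits

theorem Variety.monad_enrichedFinitary (V : Variety.{u}) : enrichedFinitary V.monad :=
  ⟨V.monad_enriched, fun _ _ _ _ => V.monad_preservesDirectedColimits⟩

/-! ### Monad morphisms correspond to concrete functors -/

section AlgebraFunctorComposition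

universe v₁ u₁

variable {C : Type u₁} [Category.{v₁} C]

theorem algebraFunctorOfMonadHom_id (T : CategoryTheory.Monad C) :
    Monad.algebraFunctorOfMonadHom (𝟙 T) = 𝟭 T.Algebra := by
  refine functor_eq_of_comp_faithful (F := T.forget) rfl fun A => ?_
  exact (algebra_eq_mk A rfl _
    ((Category.id_comp A.a).trans (castAction_rfl A).symm) _ _).symm

theorem algebraFunctorOfMonadHom_comp {R S T : CategoryTheory.Monad C} (f : R ⟶ S) (g : S ⟶ T) :
    Monad.algebraFunctorOfMonadHom (f ≫ g) =
      Monad.algebraFunctorOfMonadHom g ⋙ Monad.algebraFunctorOfMonadHom f := by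
  refine functor_eq_of_comp_faithful (F := R.forget) rfl fun A => ?_
  exact (algebra_eq_mk ((Monad.algebraFunctorOfMonadHom g ⋙
    Monad.algebraFunctorOfMonadHom f).obj A) rfl _
    ((Category.assoc _ _ _).trans (castAction_rfl ((Monad.algebraFunctorOfMonadHom g ⋙
      Monad.algebraFunctorOfMonadHom f).obj A)).symm) _ _).symm

theorem castAction_congr {S : CategoryTheory.Monad C} {X Y : S.Algebra} (h : X = Y) {B : C}
    (eX : X.A = B) (eY : Y.A = B) : castAction X eX = castAction Y eY := by
  subst h
  rfl

end AlgebraFunctorComposition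

namespace Variety

variable {V : Variety.{u}}

theorem monad_map_eval_unit {X Y : Met.{u}} (f : X ⟶ Y) {Z : Type v} (x : Z → X)
    (t : Term V.sig Z) :
    (V.monad.map f).toFun (t.eval (V.freeQAlg X) fun i => (V.freeUnit X).toFun (x i)) =
      t.eval (V.freeQAlg Y) fun i => (V.freeUnit Y).toFun (f.toFun (x i)) := by
  refine (Term.map_eval (V.free.map f).hom (fun i => (V.freeUnit X).toFun (x i)) t).trans ?_
  exact congrArg (fun g => t.eval (V.freeQAlg Y) g)
    (funext fun i => monad_map_freeMk f (.var (x i)))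

theorem comparison_a_eval_unit (B : V.Alg) {Z : Type v} (x : Z → V.forget.obj B)
    (t : Term V.sig Z) :
    (V.comparison.obj B).a.toFun
      (t.eval (V.freeQAlg (V.forget.obj B)) fun i => (V.freeUnit _).toFun (x i)) =
      t.eval B.obj x := by
  refine (Term.map_eval (V.freeLift (A := B) (𝟙 _)).hom
    (fun i => (V.freeUnit (V.forget.obj B)).toFun (x i)) t).trans ?_
  exact congrArg (fun g => t.eval B.obj g)
    (funext fun i => freeLift_freeMk (A := B) (𝟙 _) (.var (x i)))

theorem monad_map_comp_comparison_a {X : Met.{u}} (B : V.Alg) (h : X ⟶ V.forget.obj B) :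
    V.monad.map h ≫ (V.comparison.obj B).a = V.forget.map (V.freeLift h) := by
  refine Met.hom_ext fun z => ?_
  obtain ⟨t, rfl⟩ := freeMk_surjective (V := V) z
  refine (congrArg (V.comparison.obj B).a.toFun (monad_map_freeMk h t)).trans ?_
  exact (comparison_a_eval_unit B h.toFun t).trans (freeLift_freeMk h t).symm

end Variety

namespace ConcreteFunctor

variable {V W : Variety.{u}}

/-- The functor between Eilenberg-Moore categories induced by a concrete functor. -/
def algebraFunctor (H : V ⟶ W) : V.monad.Algebra ⥤ W.monad.Algebra :=
  V.comparisonInv ⋙ H.toFunctor ⋙ W.comparison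

theorem algebraFunctor_comp_forget (H : V ⟶ W) :
    algebraFunctor H ⋙ W.monad.forget = V.monad.forget :=
  congrArg (fun F => V.comparisonInv ⋙ F) H.comp_forget

/-- The monad morphism corresponding to a concrete functor. -/
def toMonadHom (H : V ⟶ W) : W.monad ⟶ V.monad :=
  monadHomOfFunctor (algebraFunctor H) (algebraFunctor_comp_forget H)

theorem algebraFunctor_toMonadHom (H : V ⟶ W) :
    Monad.algebraFunctorOfMonadHom (toMonadHom H) = algebraFunctor H :=
  algebraFunctor_monadHomOfFunctor _ _

/-- This reduces functoriality of `Φ` and surjectivity on hom-sets to equations between functors. -/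
theorem eq_toMonadHom_iff (H : V ⟶ W) (γ : W.monad ⟶ V.monad) :
    γ = toMonadHom H ↔ Monad.algebraFunctorOfMonadHom γ = algebraFunctor H := by
  rw [← algebraFunctor_toMonadHom]
  exact ⟨congrArg _, fun h => algebraFunctorOfMonadHom_injective h⟩

theorem comparison_comp_algebraFunctor (H : V ⟶ W) :
    V.comparison ⋙ algebraFunctor H = H.toFunctor ⋙ W.comparison := by
  rw [algebraFunctor, ← Functor.assoc, Variety.comparison_comp_comparisonInv, Functor.id_comp]

theorem toMonadHom_id (V : Variety.{u}) : toMonadHom (𝟙 V) = 𝟙 V.monad := by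
  refine ((eq_toMonadHom_iff _ _).2 ?_).symm
  rw [algebraFunctorOfMonadHom_id]
  exact Variety.comparisonInv_comp_comparison.symm

theorem toMonadHom_comp {U : Variety.{u}} (G : U ⟶ V) (H : V ⟶ W) :
    toMonadHom (G ≫ H) = toMonadHom H ≫ toMonadHom G := by
  refine ((eq_toMonadHom_iff _ _).2 ?_).symm
  rw [algebraFunctorOfMonadHom_comp, algebraFunctor_toMonadHom, algebraFunctor_toMonadHom]
  change U.comparisonInv ⋙ G.toFunctor ⋙ V.comparison ⋙ algebraFunctor H = _
  rw [comparison_comp_algebraFunctor]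
  rfl

theorem toMonadHom_injective : Function.Injective (toMonadHom : (V ⟶ W) → _) := by
  intro G H h
  have h' : algebraFunctor G = algebraFunctor H := by
    rw [← algebraFunctor_toMonadHom, h, algebraFunctor_toMonadHom]
  have key : ∀ F : V ⟶ W, V.comparison ⋙ algebraFunctor F ⋙ W.comparisonInv = F.toFunctor := by
    intro F
    rw [← Functor.assoc, comparison_comp_algebraFunctor, Functor.assoc,
      Variety.comparison_comp_comparisonInv, Functor.comp_id]
  exact ConcreteFunctor.ext ((key G).symm.trans ((congrArg
    (fun L => V.comparison ⋙ L ⋙ W.comparisonInv) h').trans (key H)))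

/-- The concrete functor corresponding to a monad morphism. -/
def ofMonadHom (γ : W.monad ⟶ V.monad) : V ⟶ W where
  toFunctor := V.comparison ⋙ Monad.algebraFunctorOfMonadHom γ ⋙ W.comparisonInv
  -- The underlying maps are unchanged, so the two distances coincide.
  nonexp _ _ := le_rfl
  comp_forget := rfl

theorem toMonadHom_ofMonadHom (γ : W.monad ⟶ V.monad) : toMonadHom (ofMonadHom γ) = γ := by
  refine ((eq_toMonadHom_iff _ _).2 ?_).symm
  change _ = (V.comparisonInv ⋙ V.comparison) ⋙ Monad.algebraFunctorOfMonadHom γ ⋙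
    W.comparisonInv ⋙ W.comparison
  rw [Variety.comparisonInv_comp_comparison, Variety.comparisonInv_comp_comparison]
  rfl

/-! ### Term operations in terms of monad morphisms -/

theorem toMonadHom_app_comp (G : V ⟶ W) (B : V.Alg) :
    (toMonadHom G).app (V.forget.obj B) ≫ (V.comparison.obj B).a =
      castAction (W.comparison.obj (G.toFunctor.obj B)) (forget_obj G B) := by
  refine (monadHomOfFunctor_app_comp (algebraFunctor G) (algebraFunctor_comp_forget G)
    (V.comparison.obj B)).trans ?_
  exact castAction_congr (Functor.congr_obj (comparison_comp_algebraFunctor G) B) _ _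

theorem termOp_eq (G : V ⟶ W) (B : V.Alg) {n : ℕ} (t : Term W.sig (Fin n))
    (x : Fin n → V.forget.obj B) :
    G.termOp B t x = (V.comparison.obj B).a.toFun (((toMonadHom G).app (V.forget.obj B)).toFun
      (t.eval (W.freeQAlg (V.forget.obj B)) fun i => (W.freeUnit _).toFun (x i))) := by
  have h := congrArg (fun f => f.toFun
    (t.eval (W.freeQAlg (V.forget.obj B)) fun i => (W.freeUnit _).toFun (x i)))
    (toMonadHom_app_comp G B)
  refine Eq.trans ?_ h.symm
  refine congrArg (eqToHom (forget_obj G B)).toFun ?_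
  refine Eq.symm (Eq.trans ?_ (Variety.comparison_a_eval_unit (G.toFunctor.obj B)
    (fun i => (eqToHom (forget_obj G B).symm).toFun (x i)) t))
  exact congrArg (W.comparison.obj (G.toFunctor.obj B)).a.toFun
    (Variety.monad_map_eval_unit (eqToHom (forget_obj G B).symm) x t)

/-- Naturality of the monad morphism at `h`, together with the fact that `T h` followed by the
structure map is the homomorphic extension of `h`. -/
theorem termOp_comp (G : V ⟶ W) {X : Met.{u}} (B : V.Alg) (h : X ⟶ V.forget.obj B) {n : ℕ}
    (t : Term W.sig (Fin n)) (x : Fin n → X) :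
    G.termOp B t (fun i => h.toFun (x i)) =
      (V.forget.map (V.freeLift h)).toFun (((toMonadHom G).app X).toFun
        (t.eval (W.freeQAlg X) fun i => (W.freeUnit X).toFun (x i))) := by
  rw [termOp_eq, ← Variety.monad_map_comp_comparison_a]
  have hn := congrArg (fun f => f.toFun (t.eval (W.freeQAlg X) fun i => (W.freeUnit X).toFun (x i)))
    ((toMonadHom G).naturality h)
  refine congrArg (V.comparison.obj B).a.toFun (Eq.trans ?_ hn)
  exact congrArg ((toMonadHom G).app (V.forget.obj B)).toFun
    (Variety.monad_map_eval_unit h x t).symm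

theorem termOp_free (G : V ⟶ W) (X : Met.{u}) {n : ℕ} (t : Term W.sig (Fin n)) (x : Fin n → X) :
    G.termOp (V.free.obj X) t (fun i => (V.freeUnit X).toFun (x i)) =
      ((toMonadHom G).app X).toFun
        (t.eval (W.freeQAlg X) fun i => (W.freeUnit X).toFun (x i)) := by
  refine (termOp_comp G (V.free.obj X) (V.freeUnit X) t x).trans ?_
  have h : V.freeLift (V.freeUnit X) = 𝟙 (V.freeAlg X) :=
    (Variety.freeEquiv X (V.freeAlg X)).symm_apply_eq.2 rfl
  exact congrArg (fun f : V.freeAlg X ⟶ V.freeAlg X => (V.forget.map f).toFun _) h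

end ConcreteFunctor

/-! ### Distances of monad morphisms and of concrete functors -/

theorem FinMnd.isPMetEnriched : IsPMetEnriched FinMnd.dist.{u} where
  dist_self f := by simp [FinMnd.dist, Met.homDist]
  dist_comm f g := by simp only [FinMnd.dist, Met.homDist, edist_comm]
  dist_triangle f g h := iSup_le fun n => iSup_le fun x =>
    (edist_triangle _ ((g.hom.app (Met.disc n)).toFun x) _).trans (add_le_add
      (le_iSup₂_of_le n x le_rfl) (le_iSup₂_of_le n x le_rfl))
  dist_comp f f' g g' := iSup_le fun n => iSup_le fun x => by
    -- The intermediate point is `g'(f x)`: one summand is bounded by nonexpansion of `g'`, the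
    -- other by the distance of `g` and `g'` at `f x`.
    refine (edist_triangle _ ((g'.hom.app (Met.disc n)).toFun
      ((f.hom.app (Met.disc n)).toFun x)) _).trans ?_
    rw [add_comm]
    exact add_le_add
      (((g'.hom.app (Met.disc n)).nonexp _ _).trans (le_iSup₂_of_le n x le_rfl))
      (le_iSup₂_of_le n ((f.hom.app (Met.disc n)).toFun x) le_rfl)

/-- Renaming of variables. -/
def Term.rename {S : Signature.{u}} {X Y : Type*} (g : X → Y) : Term S X → Term S Y
  | .var x => .var (g x)
  | .op σ ts => .op σ (fun i => Term.rename g (ts i))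

theorem Term.eval_rename {S : Signature.{u}} (A : QAlg S) {X Y : Type*} (g : X → Y)
    (f : Y → A.toMet) (t : Term S X) : (t.rename g).eval A f = t.eval A (fun x => f (g x)) := by
  induction t with
  | var x => rfl
  | op σ ts ih => exact congrArg (A.op σ) (funext ih)

/-- A finite family of points, as a map out of a discrete space. -/
def Met.ofFamily {n : ℕ} {X : Met.{u}} (x : Fin n → X) : Met.disc.{u} n ⟶ X where
  toFun i := x i.down
  nonexp i j := by
    by_cases h : i = j
    · rw [h, edist_self]
      exact zero_le
    · exact le_top.trans_eq (if_neg (c := @Eq (ULift.{u} (Fin n)) i j) h).symm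

/-! ### Full faithfulness of `Φ` and preservation of distances -/

variable {V W : Variety.{u}}

theorem Variety.exists_eval_disc {n : ℕ} (z : V.freeMet (Met.disc n)) :
    ∃ t : Term V.sig (Fin n), t.eval (V.freeQAlg (Met.disc n))
      (fun i => (V.freeUnit (Met.disc n)).toFun ⟨i⟩) = z := by
  obtain ⟨t, rfl⟩ := Variety.freeMk_surjective (V := V) z
  refine ⟨Term.rename (S := V.sig) ULift.down t, ?_⟩
  exact (Term.eval_rename _ _ _ _).trans (Variety.freeMk_eq_eval t).symm

/-- The functor `Φ`. -/
def toFinMnd : Variety.{u}ᵒᵖ ⥤ FinMnd.{u} where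
  obj V := ⟨V.unop.monad, V.unop.monad_enrichedFinitary⟩
  map f := ObjectProperty.homMk (ConcreteFunctor.toMonadHom f.unop)
  map_id V := ObjectProperty.hom_ext _ (ConcreteFunctor.toMonadHom_id V.unop)
  map_comp f g := ObjectProperty.hom_ext _ (ConcreteFunctor.toMonadHom_comp g.unop f.unop)

theorem toFinMnd_dist (G H : V ⟶ W) :
    FinMnd.dist (toFinMnd.map G.op) (toFinMnd.map H.op) = Variety.dist G H := by
  refine le_antisymm ?_ ?_
  · refine iSup_le fun n => iSup_le fun z => ?_
    obtain ⟨t, rfl⟩ := Variety.exists_eval_disc (V := W) z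
    -- The witness is `k = n` with the tuple of generators of the free algebra on `n`.
    refine Eq.trans_le ?_ (le_iSup_of_le n (le_iSup_of_le n (le_iSup₂_of_le t
      (fun i => (V.freeUnit (Met.disc n)).toFun ⟨i⟩) le_rfl)))
    exact (congrArg₂ edist (ConcreteFunctor.termOp_free G (Met.disc n) t fun i => ⟨i⟩)
      (ConcreteFunctor.termOp_free H (Met.disc n) t fun i => ⟨i⟩)).symm
  · refine iSup_le fun n => iSup_le fun k => iSup₂_le fun t x => ?_
    -- A tuple in the free algebra on `k` is a map out of the discrete space `n`, and its
    -- homomorphic extension is nonexpanding.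
    refine (congrArg₂ edist
      (ConcreteFunctor.termOp_comp G _ (Met.ofFamily x) t fun i => ⟨i⟩)
      (ConcreteFunctor.termOp_comp H _ (Met.ofFamily x) t fun i => ⟨i⟩)).trans_le ?_
    exact ((V.forget.map (V.freeLift (Met.ofFamily x))).nonexp _ _).trans
      (le_iSup₂_of_le n _ le_rfl)

theorem toFinMnd_isEnrichedFullyFaithful :
    IsEnrichedFullyFaithful Variety.dist.{u}.op FinMnd.dist.{u} toFinMnd where
  bijective X Y := by
    refine ⟨fun f g h => Quiver.Hom.unop_inj (ConcreteFunctor.toMonadHom_injective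
      (congrArg (fun φ => φ.hom) h)), fun φ => ?_⟩
    exact ⟨(ConcreteFunctor.ofMonadHom φ.hom).op,
      ObjectProperty.hom_ext _ (ConcreteFunctor.toMonadHom_ofMonadHom φ.hom)⟩
  dist_map f g := toFinMnd_dist f.unop g.unop

/-- All laws are pulled back along the distance-preserving functor `Φ`, whose contravariance swaps
the summands in `dist_comp`. -/
theorem Variety.isPMetEnriched : IsPMetEnriched Variety.dist.{u} where
  dist_self f := by rw [← toFinMnd_dist, FinMnd.isPMetEnriched.dist_self]
  dist_comm f g := by rw [← toFinMnd_dist, ← toFinMnd_dist, FinMnd.isPMetEnriched.dist_comm]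
  dist_triangle f g h := by
    simp only [← toFinMnd_dist]
    exact FinMnd.isPMetEnriched.dist_triangle _ _ _
  dist_comp f f' g g' := by
    simp only [← toFinMnd_dist, op_comp, Functor.map_comp]
    rw [add_comm]
    exact FinMnd.isPMetEnriched.dist_comp _ _ _ _

end MetVar

end

theorem proposition4p7 :
    MetVar.IsPMetEnriched MetVar.Variety.dist.{u} ∧
    MetVar.IsPMetEnriched MetVar.FinMnd.dist.{u} ∧
    ∃ Kinv : ∀ V : MetVar.Variety.{u}, V.monad.Algebra ⥤ V.Alg,
      (∀ V : MetVar.Variety.{u},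
        V.comparison ⋙ Kinv V = 𝟭 V.Alg ∧ Kinv V ⋙ V.comparison = 𝟭 V.monad.Algebra) ∧
      ∃ (Φ : MetVar.Variety.{u}ᵒᵖ ⥤ MetVar.FinMnd.{u})
        (hΦ : ∀ V : MetVar.Variety.{u}, (Φ.obj (Opposite.op V)).obj = V.monad),
        (∀ (V W : MetVar.Variety.{u}) (H : V ⟶ W) (γ : W.monad ⟶ V.monad),
          γ = eqToHom (hΦ W).symm ≫ (Φ.map H.op).hom ≫ eqToHom (hΦ V) ↔
            Monad.algebraFunctorOfMonadHom γ = Kinv V ⋙ H.toFunctor ⋙ W.comparison) ∧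
        MetVar.IsEnrichedFunctor MetVar.Variety.dist.{u}.op MetVar.FinMnd.dist.{u} Φ ∧
        MetVar.IsEnrichedFullyFaithful MetVar.Variety.dist.{u}.op MetVar.FinMnd.dist.{u} Φ := by
  refine ⟨MetVar.Variety.isPMetEnriched, MetVar.FinMnd.isPMetEnriched,
    MetVar.Variety.comparisonInv, fun V => ⟨MetVar.Variety.comparison_comp_comparisonInv,
      MetVar.Variety.comparisonInv_comp_comparison⟩, MetVar.toFinMnd, fun V => rfl,
    fun V W H γ => ?_, fun f g => (MetVar.toFinMnd_isEnrichedFullyFaithful.dist_map f g).le,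
    MetVar.toFinMnd_isEnrichedFullyFaithful⟩
  refine Iff.trans ?_ (MetVar.ConcreteFunctor.eq_toMonadHom_iff H γ)
  refine Eq.congr_right ?_
  -- `hΦ` holds definitionally, so both `eqToHom` are identities.
  exact (Category.id_comp _).trans (Category.comp_id (MetVar.ConcreteFunctor.toMonadHom H))
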